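/- Let $X$ be $c_0$ or $\ell^p$ with $1\le p<\infty$ (complex sequence spaces indexed by $\mathbb N$). Let $\mathcal B(X)$ be the Banach algebra of bounded linear operators on $X$, let $\mathcal K(X)$ be the closed two-sided ideal of compact operators, and give $\mathcal B(X)/\mathcal K(X)$ the quotient norm. (i) For every $a\in\mathcal B(X)/\mathcal K(X)$ with $\|a\|=1$ there exist $b,c\in\mathcal B(X)/\mathcal K(X)$ such that $1=bac$ and $\|b\|\,\|c\|=1$. (ii) For every set $I$ and every countably-incomplete ultrafilter $\mathcal U$ on $I$ (one that is not closed under countable intersections; for $I=\mathbb N$ this means non-principal), the ultrapower $(\mathcal B(X)/\mathcal K(X))_{\mathcal U}$ is purely infinite. Here, for a unital Banach algebra $\mathcal A$, the ultrapower is $(\mathcal A)_{\mathcal U}=\ell^\infty(I,\mathcal A)/\{(a_i)\in\ell^\infty(I,\mathcal A):\lim_{i\to\mathcal U}\|a_i\|=0\}$. A complex unital algebra $\mathcal A$ is purely infinite if it is not a division algebra and for every non-zero $a\in\mathcal A$ there are $b,c\in\mathcal A$ with $1=bac$. -/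

import Mathlib

open Filter Topology
open scoped ENNReal ZeroAtInfty

noncomputable section

/-! ### Purely infinite algebras -/

/-- A unital algebra is purely infinite if it is not a division algebra and if `1` factors through
every non-zero element. (In the zero ring the first conjunct fails, so a purely infinite algebra is
automatically non-zero.) -/
def IsPurelyInfinite (A : Type*) [Ring A] : Prop :=
  (¬ ∀ a : A, a ≠ 0 → IsUnit a) ∧ ∀ a : A, a ≠ 0 → ∃ b c : A, 1 = b * a * c

/-! ### Quotients of normed rings by closed two-sided ideals -/

section Quotient

variable {R : Type*} [NormedRing R] (I : Ideal R) [I.IsTwoSided] [IsClosed (I : Set R)]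

/-- The quotient norm on `R ⧸ I`, for a closed two-sided ideal `I`, is a ring norm. The norm is
Mathlib's quotient norm (the distance to `I`), the ring structure is Mathlib's. -/
abbrev twoSidedQuotientNormedRing : NormedRing (R ⧸ I) :=
  { Ideal.Quotient.ring I, Submodule.Quotient.normedAddCommGroup I with
    norm_mul_le := fun x y => by
      refine le_of_forall_gt_imp_ge_of_dense fun r hr => ?_
      have hc : Tendsto (fun ε : ℝ => (‖x‖ + ε) * (‖y‖ + ε)) (𝓝[>] 0)
          (𝓝 ((‖x‖ + 0) * (‖y‖ + 0))) :=
        tendsto_nhdsWithin_of_tendsto_nhds (Continuous.tendsto (by fun_prop) 0)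
      simp only [add_zero] at hc
      obtain ⟨ε, hε, hε0⟩ := ((hc.eventually (gt_mem_nhds hr)).and
        (self_mem_nhdsWithin : Set.Ioi (0 : ℝ) ∈ 𝓝[>] 0)).exists
      obtain ⟨a, rfl, ha⟩ := Submodule.Quotient.norm_mk_lt x hε0
      obtain ⟨b, rfl, hb⟩ := Submodule.Quotient.norm_mk_lt y hε0
      calc _ ≤ ‖a * b‖ := Submodule.Quotient.norm_mk_le I (a * b)
        _ ≤ ‖a‖ * ‖b‖ := norm_mul_le a b
        _ ≤ _ := (mul_le_mul ha.le hb.le (norm_nonneg _)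
          ((norm_nonneg a).trans ha.le)).trans hε.le }

end Quotient

/-! ### The Calkin algebra -/

section Calkin

variable (X : Type*) [NormedAddCommGroup X] [NormedSpace ℂ X]

/-- The ideal of compact operators in the algebra of bounded operators on `X`. -/
def compactIdeal : Ideal (X →L[ℂ] X) where
  carrier := {T | IsCompactOperator T}
  add_mem' hf hg := hf.add hg
  zero_mem' := isCompactOperator_zero
  smul_mem' S _ hT := hT.clm_comp S

instance : (compactIdeal X).IsTwoSided where
  mul_mem_of_left S hT := IsCompactOperator.comp_clm hT S

instance [CompleteSpace X] : IsClosed (compactIdeal X : Set (X →L[ℂ] X)) :=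
  isClosed_setOfPred_isCompactOperator

/-- The Calkin algebra of `X`: bounded operators modulo compact operators. -/
abbrev Calkin : Type _ := (X →L[ℂ] X) ⧸ compactIdeal X

instance [CompleteSpace X] : NormedRing (Calkin X) := twoSidedQuotientNormedRing (compactIdeal X)

instance [CompleteSpace X] : NormedAlgebra ℂ (Calkin X) :=
  { Submodule.Quotient.normedSpace (compactIdeal X) ℂ,
    (Ideal.Quotient.algebra ℂ : Algebra ℂ (Calkin X)) with }

/-- The unit of the Calkin algebra of an infinite-dimensional Banach space has norm one. -/
instance [CompleteSpace X] [hX : Fact (¬ FiniteDimensional ℂ X)] : NormOneClass (Calkin X) where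
  norm_one := by
    have h1 : (1 : Calkin X) ≠ 0 := fun h => hX.out <| by
      have : (1 : X →L[ℂ] X) ∈ compactIdeal X := Ideal.Quotient.eq_zero_iff_mem.1 h
      exact (isCompactOperator_id_iff_finiteDimensional (𝕜 := ℂ)).1 this
    have : Nontrivial (Calkin X) := ⟨⟨1, 0, h1⟩⟩
    refine le_antisymm ?_ (one_le_norm_one _)
    exact (Submodule.Quotient.norm_mk_le (compactIdeal X) 1).trans
      ContinuousLinearMap.norm_id_le

end Calkin

/-! ### Ultrapowers -/

section Ultrapower

variable {ι : Type*} (U : Ultrafilter ι) (A : Type*) [NormedRing A] [NormOneClass A]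

/-- The ideal, in the algebra of bounded families in `A`, of the families whose norm tends to `0`
along `U`. -/
def nullIdeal : Ideal (lp (fun _ : ι => A) ∞) where
  carrier := {a | Tendsto (fun i => ‖a i‖) U (𝓝 0)}
  add_mem' {a b} ha hb := by
    refine squeeze_zero (fun i => norm_nonneg _) (fun i => ?_)
      (by simpa using Tendsto.add (Set.mem_ofPred.1 ha) (Set.mem_ofPred.1 hb))
    exact norm_add_le (a i) (b i)
  zero_mem' := by simp
  smul_mem' a b hb := by
    refine squeeze_zero (fun i => norm_nonneg _) (fun i => ?_)
      (by simpa using Tendsto.const_mul ‖a‖ (Set.mem_ofPred.1 hb))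
    exact (norm_mul_le (a i) (b i)).trans
      (mul_le_mul_of_nonneg_right (lp.norm_apply_le_norm ENNReal.top_ne_zero a i) (norm_nonneg _))

instance : (nullIdeal U A).IsTwoSided where
  mul_mem_of_left {a} b ha := by
    refine squeeze_zero (fun i => norm_nonneg _) (fun i => ?_)
      (by simpa using Tendsto.mul_const ‖b‖ (Set.mem_ofPred.1 ha))
    exact (norm_mul_le (a i) (b i)).trans
      (mul_le_mul_of_nonneg_left (lp.norm_apply_le_norm ENNReal.top_ne_zero b i) (norm_nonneg _))

instance : IsClosed (nullIdeal U A : Set (lp (fun _ : ι => A) ∞)) := by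
  refine isClosed_of_closure_subset fun a ha => ?_
  refine Metric.tendsto_nhds.2 fun ε hε => ?_
  obtain ⟨b, hb, hab⟩ := Metric.mem_closure_iff.1 ha (ε / 2) (half_pos hε)
  have hb' : Tendsto (fun i => ‖b i‖) U (𝓝 0) := hb
  filter_upwards [Metric.tendsto_nhds.1 hb' (ε / 2) (half_pos hε)] with i hi
  have h2 : ‖a i - b i‖ ≤ ‖a - b‖ := lp.norm_apply_le_norm ENNReal.top_ne_zero (a - b) i
  have h3 := norm_sub_norm_le (a i) (b i)
  rw [dist_eq_norm] at hab
  simp only [dist_zero_right, norm_norm] at hi ⊢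
  linarith

/-- The ultrapower of a unital Banach algebra along an ultrafilter. -/
abbrev BanachUltrapower : Type _ := lp (fun _ : ι => A) ∞ ⧸ nullIdeal U A

instance : NormedRing (BanachUltrapower U A) := twoSidedQuotientNormedRing (nullIdeal U A)

instance [NormedAlgebra ℂ A] : NormedAlgebra ℂ (BanachUltrapower U A) :=
  { Submodule.Quotient.normedSpace (nullIdeal U A) ℂ,
    (Ideal.Quotient.algebra ℂ : Algebra ℂ (BanachUltrapower U A)) with }

end Ultrapower

/-! ### The sequence spaces are infinite-dimensional -/

theorem not_finiteDimensional_of_single {X : Type*} [AddCommGroup X] [Module ℂ X]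
    (f : X →ₗ[ℂ] ℕ → ℂ) (e : ℕ → X) (he : ∀ n, f (e n) = Pi.single n 1) :
    ¬ FiniteDimensional ℂ X := fun _ => by
  have h : LinearIndependent ℂ (f ∘ e) := by
    rw [linearIndependent_iff']
    intro s g hg i hi
    have := congrFun hg i
    simpa [he, Pi.single_apply, hi] using this
  have := (LinearIndependent.of_comp f h).finite
  exact not_finite ℕ

instance (p : ℝ≥0∞) [Fact (1 ≤ p)] : Fact (¬ FiniteDimensional ℂ (lp (fun _ : ℕ => ℂ) p)) where
  out := not_finiteDimensional_of_single
    { toFun := fun x => ⇑x, map_add' := fun _ _ => rfl, map_smul' := fun _ _ => rfl }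
    (fun n => lp.single p n 1) (fun n => lp.coeFn_single p n 1)

/-- The space `c₀` is `C₀(ℕ, ℂ)`, the functions on the discrete space `ℕ` that vanish at infinity,
with the supremum norm. -/
instance : Fact (¬ FiniteDimensional ℂ C₀(ℕ, ℂ)) where
  out := not_finiteDimensional_of_single
    { toFun := fun x => ⇑x, map_add' := fun _ _ => rfl, map_smul' := fun _ _ => rfl }
    (fun n => ⟨⟨Pi.single n 1, continuous_of_discreteTopology⟩, by
      rw [cocompact_eq_cofinite, Nat.cofinite_eq_atTop]
      refine tendsto_const_nhds.congr' ?_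
      filter_upwards [eventually_gt_atTop n] with m hm
      simp [hm.ne']⟩)
    (fun n => rfl)

end

/-! ### Sequence spaces -/

/-! Let `T` have essential norm one. Finite coordinate projections are compact, so cutting `T` off
below `m` on both sides leaves its class unchanged and its norm at least one. Hence there are
successive finitely supported blocks `z k` in the unit ball whose images have norm almost one past
the start of the block, and disjointness of the blocks makes `e k ↦ z k` a contraction. By Tychonoff
the images converge coordinatewise along a subsequence. In `c₀` and in `ℓᵖ` with `p > 1` the limit
is zero, since `N` unit vectors have a sum of norm `o(N)`; in `ℓ¹` it may be non-zero but is removed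
by a rank-one operator. This gives `exists_coordinatewise_null`.

A gliding hump (`exists_hump`) then finds a further subsequence of images that are nearly disjoint
blocks, each nearly normed to one by a contractive functional. These functionals assemble to a
contraction `B` with `B * S * C` equal to the identity up to a summable, hence compact, error
(`exists_contractions_one_sub_mem`). Both factors are contractions in the quotient, and `‖1‖ = 1`
forces the product of their norms to be one.

This control of norms passes to ultrapowers: a non-zero element has a representative bounded below
on a large set of indices, and the factors chosen at each index form bounded families. Zero divisors
come from the projections onto the even and the odd coordinates. -/

/-- A Banach space of complex sequences in which the unit vectors form a normalised basis, which is
solid, in which norms of disjointly supported vectors combine compatibly, and in which an operator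
mapping the unit vectors to a coordinatewise convergent sequence agrees in the limit with a
compact one. -/
class SequenceSpace (X : Type*) [NormedAddCommGroup X] [NormedSpace ℂ X] where
  /-- The sequence of coordinates. -/
  coords : X →ₗ[ℂ] ℕ → ℂ
  norm_coords_le : ∀ x n, ‖coords x n‖ ≤ ‖x‖
  /-- The unit vectors. -/
  basis : ℕ → X
  coords_basis : ∀ n, coords (basis n) = Pi.single n 1
  norm_basis_le : ∀ n, ‖basis n‖ ≤ 1
  hasSum_basis : ∀ x, HasSum (fun n => coords x n • basis n) x
  exists_of_norm_le : ∀ (x : X) (f : ℕ → ℂ), (∀ n, ‖f n‖ ≤ ‖coords x n‖) →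
    ∃ y, coords y = f ∧ ‖y‖ ≤ ‖x‖
  -- Separate labels `δ` for the source and `κ` for the target let one axiom serve both maps `e k ↦
  -- z k` into blocks (`δ = id`) and maps from blocks to unit vectors (`κ = id`).
  exists_blockwise : ∀ (x : X) (δ κ : ℕ → ℕ) (u v : ℕ → X),
    (∀ k n, coords (u k) n = if δ n = k then coords x n else 0) → (∀ k, ‖v k‖ ≤ ‖u k‖) →
    ∃ y, (coords y = fun n => coords (v (κ n)) n) ∧ ‖y‖ ≤ ‖x‖
  exists_compact_of_tendsto : ∀ (S : X →L[ℂ] X) (g : ℕ → ℂ),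
    (∀ n, Tendsto (fun k => coords (S (basis k)) n) atTop (𝓝 (g n))) →
    ∃ K ∈ compactIdeal X, ∀ k, coords (K (basis k)) = g

theorem smulRight_mem_compactIdeal {X : Type*} [NormedAddCommGroup X] [NormedSpace ℂ X]
    (f : X →L[ℂ] ℂ) (y : X) : f.smulRight y ∈ compactIdeal X :=
  (isCompactOperator_of_locallyCompactSpace_rng
    (ContinuousLinearMap.toSpanSingleton ℂ y)).comp_clm f

theorem norm_apply_le_of_norm_le_one {X Y : Type*} [NormedAddCommGroup X] [NormedSpace ℂ X]
    [NormedAddCommGroup Y] [NormedSpace ℂ Y]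
    {B : X →L[ℂ] Y} (hB : ‖B‖ ≤ 1) (x : X) : ‖B x‖ ≤ ‖x‖ := by
  simpa using B.le_of_opNorm_le hB x

theorem norm_smulRight_le_one {X : Type*} [NormedAddCommGroup X] [NormedSpace ℂ X]
    (f : X →L[ℂ] ℂ) (y : X) (hf : ‖f‖ ≤ 1) (hy : ‖y‖ ≤ 1) :
    ‖f.smulRight y‖ ≤ 1 := by
  rw [ContinuousLinearMap.norm_smulRight_apply]
  exact mul_le_one₀ hf (norm_nonneg _) hy

/-! ### Coordinate projections, blockwise contractions and compactness. -/

namespace SequenceSpace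

section

variable {X : Type*} [NormedAddCommGroup X] [NormedSpace ℂ X] [SequenceSpace X]

theorem coords_injective : Function.Injective (coords : X →ₗ[ℂ] ℕ → ℂ) := fun x y h => by
  have hx := hasSum_basis x
  rw [h] at hx
  exact hx.unique (hasSum_basis y)

/-- The coordinate functionals. -/
noncomputable def coord (n : ℕ) : X →L[ℂ] ℂ :=
  ((LinearMap.proj n).comp coords : X →ₗ[ℂ] ℂ).mkContinuous 1
    fun x => by simpa using norm_coords_le x n

@[simp]
theorem coord_apply (n : ℕ) (x : X) : coord n x = coords x n := rfl

theorem norm_coord_le (n : ℕ) : ‖(coord n : X →L[ℂ] ℂ)‖ ≤ 1 :=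
  LinearMap.mkContinuous_norm_le _ zero_le_one _

theorem exists_clm_of_coords (L : X →ₗ[ℂ] ℕ → ℂ) (h : ∀ x, ∃ y : X, coords y = L x ∧ ‖y‖ ≤ ‖x‖) :
    ∃ B : X →L[ℂ] X, ‖B‖ ≤ 1 ∧ ∀ x, coords (B x) = L x := by
  choose b hb hb' using h
  refine ⟨LinearMap.mkContinuous
    { toFun := b
      map_add' := fun x y => coords_injective (by simp [hb])
      map_smul' := fun c x => coords_injective (by simp [hb]) } 1 fun x => by simpa using hb' x,
    LinearMap.mkContinuous_norm_le _ zero_le_one _, hb⟩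

theorem exists_proj (A : Set ℕ) : ∃ P : X →L[ℂ] X, ‖P‖ ≤ 1 ∧
    ∀ x, coords (P x) = A.indicator (coords x) := by
  refine exists_clm_of_coords
    { toFun := fun x => A.indicator (coords x)
      map_add' := fun x y => by simp [Set.indicator_add']
      map_smul' := fun c x => by
        ext n
        by_cases hn : n ∈ A <;> simp [hn] } fun x => exists_of_norm_le _ _ fun n => ?_
  exact norm_indicator_le_norm_self _ _

/-- The coordinate projection onto the sequences supported in `A`. -/
noncomputable def proj (A : Set ℕ) : X →L[ℂ] X := (exists_proj A).choose

theorem norm_proj_le (A : Set ℕ) : ‖(proj A : X →L[ℂ] X)‖ ≤ 1 := (exists_proj A).choose_spec.1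

@[simp]
theorem coords_proj (A : Set ℕ) (x : X) : coords (proj A x) = A.indicator (coords x) :=
  (exists_proj A).choose_spec.2 x

theorem norm_proj_apply_le (A : Set ℕ) (x : X) : ‖proj A x‖ ≤ ‖x‖ :=
  norm_apply_le_of_norm_le_one (norm_proj_le A) x

theorem proj_proj (A B : Set ℕ) (x : X) : proj A (proj B x) = proj (A ∩ B) x :=
  coords_injective (by simp [Set.indicator_indicator])

theorem sub_proj_apply (A : Set ℕ) (x : X) : x - proj A x = proj Aᶜ x :=
  coords_injective (by simp [Set.indicator_compl])

theorem proj_empty (x : X) : proj ∅ x = 0 := coords_injective (by simp; rfl)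

theorem proj_Iio_eq_sum (n : ℕ) (x : X) :
    proj (Set.Iio n) x = ∑ i ∈ Finset.range n, coords x i • basis i := by
  refine coords_injective ?_
  ext j
  simp [coords_basis, Set.indicator_apply, Pi.single_apply]

theorem tendsto_proj_Iio (x : X) :
    Tendsto (fun n => proj (Set.Iio n) x) atTop (𝓝 x) := by
  simpa only [proj_Iio_eq_sum] using (hasSum_basis x).tendsto_sum_nat

theorem proj_Iio_mem_compactIdeal (n : ℕ) : (proj (Set.Iio n) : X →L[ℂ] X) ∈ compactIdeal X := by
  have : (proj (Set.Iio n) : X →L[ℂ] X) =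
      ∑ i ∈ Finset.range n, (coord i).smulRight (basis i) := by
    ext x
    simp [proj_Iio_eq_sum]
  rw [this]
  exact sum_mem fun i _ => smulRight_mem_compactIdeal _ _

/-- Operators may be combined blockwise without increasing the norm. -/
theorem exists_clm_blockwise (δ κ : ℕ → ℕ) (A : ℕ → X →L[ℂ] X) (hA : ∀ k, ‖A k‖ ≤ 1) :
    ∃ B : X →L[ℂ] X, ‖B‖ ≤ 1 ∧
      ∀ x n, coords (B x) n = coords (A (κ n) (proj (δ ⁻¹' {κ n}) x)) n := by
  obtain ⟨B, hB, h⟩ := exists_clm_of_coords (X := X)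
    { toFun := fun x n => coords (A (κ n) (proj (δ ⁻¹' {κ n}) x)) n
      map_add' := fun x y => by ext n; simp
      map_smul' := fun c x => by ext n; simp } fun x => by
      refine exists_blockwise x δ κ (fun k => proj (δ ⁻¹' {k}) x)
        (fun k => A k (proj (δ ⁻¹' {k}) x)) (fun k n => ?_)
        fun k => norm_apply_le_of_norm_le_one (hA k) _
      by_cases hn : δ n = k <;> simp [hn]
  exact ⟨B, hB, fun x n => congrFun (h x) n⟩

/-- The label `κ` expresses that the supports are disjoint, so the rank-one contractions sending
`basis k` to `z k` can be combined blockwise. -/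
theorem exists_clm_apply_basis (z : ℕ → X) (κ : ℕ → ℕ) (hκ : ∀ k n, coords (z k) n ≠ 0 → κ n = k)
    (hz : ∀ k, ‖z k‖ ≤ 1) : ∃ C : X →L[ℂ] X, ‖C‖ ≤ 1 ∧ ∀ k, C (basis k) = z k := by
  obtain ⟨C, hC, h⟩ := exists_clm_blockwise id κ (fun k => (coord k).smulRight (z k))
    fun k => norm_smulRight_le_one _ _ (norm_coord_le k) (hz k)
  refine ⟨C, hC, fun k => coords_injective ?_⟩
  ext n
  rw [h]
  have := hκ k n
  by_cases hn : κ n = k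
  · simp [hn, coords_basis]
  · have h0 : coords (z k) n = 0 := by_contra fun h => hn (this h)
    simp [h0, coords_basis, hn]

theorem exists_clm_basis_comp (j : ℕ → ℕ) (hj : Function.Injective j) :
    ∃ C : X →L[ℂ] X, ‖C‖ ≤ 1 ∧ ∀ k, C (basis k) = basis (j k) := by
  refine exists_clm_apply_basis _ (Function.invFun j) (fun k n hn => ?_) fun k => norm_basis_le _
  obtain rfl : n = j k := by
    by_contra h
    simp [coords_basis, h] at hn
  exact Function.leftInverse_invFun hj k

/-- The counterpart of `exists_clm_apply_basis`: disjointness is now in the source, and each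
rank-one block sends `D k` to the line of `basis k`. -/
theorem exists_clm_of_functionals (f : ℕ → X →L[ℂ] ℂ) (hf : ∀ k, ‖f k‖ ≤ 1) (κ : ℕ → ℕ)
    (D : ℕ → Set ℕ) (hκ : ∀ k, ∀ n ∈ D k, κ n = k) :
    ∃ B : X →L[ℂ] X, ‖B‖ ≤ 1 ∧ ∀ x k, coords (B x) k = f k (proj (D k) x) := by
  obtain ⟨B, hB, h⟩ := exists_clm_blockwise κ id
    (fun k => ((f k).comp (proj (D k))).smulRight (basis k : X))
    fun k => norm_smulRight_le_one _ _
      ((ContinuousLinearMap.opNorm_comp_le _ _).trans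
        (mul_le_one₀ (hf k) (norm_nonneg _) (norm_proj_le _))) (norm_basis_le k)
  refine ⟨B, hB, fun x k => ?_⟩
  have : D k ∩ κ ⁻¹' {k} = D k := Set.inter_eq_left.2 (hκ k)
  rw [h]
  simp [coords_basis, proj_proj, this]

/-- Coordinate functionals are contractive, so the expansion of `R` into rank-one operators
converges in operator norm. -/
theorem mem_compactIdeal_of_summable [CompleteSpace X] (R : X →L[ℂ] X)
    (hR : Summable fun n => ‖R (basis n)‖) : R ∈ compactIdeal X := by
  have hs : Summable fun n => (coord n : X →L[ℂ] ℂ).smulRight (R (basis n)) := by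
    refine Summable.of_norm_bounded hR fun n => ?_
    rw [ContinuousLinearMap.norm_smulRight_apply]
    exact mul_le_of_le_one_left (norm_nonneg _) (norm_coord_le n)
  have hR' : R = ∑' n, (coord n).smulRight (R (basis n)) := by
    ext x
    have h1 := (hs.hasSum.mapL (ContinuousLinearMap.apply ℂ X x))
    have h2 := (hasSum_basis x).mapL R
    refine h2.unique ?_
    simpa using h1
  have hcl : IsClosed (compactIdeal X : Set (X →L[ℂ] X)) := inferInstance
  rw [hR']
  exact hcl.mem_of_tendsto hs.hasSum
    (Eventually.of_forall fun s => sum_mem fun i _ => smulRight_mem_compactIdeal _ _)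

end

end SequenceSpace

/-- The recursion behind both block constructions: each block `[m, m')` starts where the previous
one ended. -/
theorem exists_strictMono_seq {α : Type*} {P : ℕ → ℕ → ℕ → α → Prop}
    (h : ∀ k m, ∃ m' > m, ∃ a, P k m m' a) :
    ∃ (n : ℕ → ℕ) (a : ℕ → α), StrictMono n ∧ ∀ k, P k (n k) (n (k + 1)) (a k) := by
  choose M hM a ha using h
  let n : ℕ → ℕ := fun k => Nat.rec 0 (fun k m => M k m) k
  exact ⟨n, fun k => a k (n k), strictMono_nat_of_lt_succ fun k => hM k (n k), fun k => ha k (n k)⟩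

theorem StrictMono.exists_block_index {n : ℕ → ℕ} (hn : StrictMono n) :
    ∃ κ : ℕ → ℕ, ∀ k, ∀ i ∈ Set.Ico (n k) (n (k + 1)), κ i = k := by
  classical
  refine ⟨fun i => if h : ∃ k, i ∈ Set.Ico (n k) (n (k + 1)) then h.choose else 0, fun k i hi => ?_⟩
  have h : ∃ k, i ∈ Set.Ico (n k) (n (k + 1)) := ⟨k, hi⟩
  beta_reduce
  rw [dif_pos h]
  by_contra hne
  exact Set.disjoint_left.1 (hn.monotone.pairwise_disjoint_on_Ico_succ hne) h.choose_spec hi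

/-! ### Factoring the unit through elements of norm one of the Calkin algebra -/

namespace SequenceSpace

section

variable {X : Type*} [NormedAddCommGroup X] [NormedSpace ℂ X] [SequenceSpace X]

theorem one_le_norm_compl_mul_mul_compl [CompleteSpace X] (T : X →L[ℂ] X)
    (hT : ‖(Ideal.Quotient.mk (compactIdeal X) T : Calkin X)‖ = 1) (m : ℕ) :
    1 ≤ ‖(1 - proj (Set.Iio m)) * T * (1 - proj (Set.Iio m))‖ := by
  have h0 : (Ideal.Quotient.mk (compactIdeal X) (proj (Set.Iio m)) : Calkin X) = 0 :=
    Ideal.Quotient.eq_zero_iff_mem.2 (proj_Iio_mem_compactIdeal m)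
  have h : (Ideal.Quotient.mk (compactIdeal X)
      ((1 - proj (Set.Iio m)) * T * (1 - proj (Set.Iio m))) : Calkin X) =
      Ideal.Quotient.mk (compactIdeal X) T := by
    simp only [map_mul, map_sub, map_one, h0, sub_zero, one_mul, mul_one]
  rw [← hT, ← h]
  exact Submodule.Quotient.norm_mk_le (compactIdeal X) _

theorem exists_block_norm_gt [CompleteSpace X] (T : X →L[ℂ] X)
    (hT : ‖(Ideal.Quotient.mk (compactIdeal X) T : Calkin X)‖ = 1) (m : ℕ) {ε : ℝ} (hε : 0 < ε) :
    ∃ m' > m, ∃ z : X, ‖z‖ ≤ 1 ∧ (∀ n, coords z n ≠ 0 → n ∈ Set.Ico m m') ∧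
      1 - ε < ‖T z - proj (Set.Iio m) (T z)‖ := by
  obtain ⟨x, hx1, hx⟩ := ContinuousLinearMap.exists_lt_apply_of_lt_opNorm _
    (show 1 - ε < ‖(1 - proj (Set.Iio m)) * T * (1 - proj (Set.Iio m))‖ by
      linarith [one_le_norm_compl_mul_mul_compl T hT m])
  -- Truncating the nearly norming vector far out makes its support finite and, by continuity, keeps
  -- the strict bound.
  have ht : Tendsto (fun n => ‖T (proj (Set.Iio n) (proj (Set.Iio m)ᶜ x)) -
      proj (Set.Iio m) (T (proj (Set.Iio n) (proj (Set.Iio m)ᶜ x)))‖) atTop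
      (𝓝 ‖T (proj (Set.Iio m)ᶜ x) - proj (Set.Iio m) (T (proj (Set.Iio m)ᶜ x))‖) := by
    have h1 := (T.continuous.tendsto _).comp (tendsto_proj_Iio (proj (Set.Iio m)ᶜ x))
    exact (h1.sub (((proj (Set.Iio m)).continuous.tendsto _).comp h1)).norm
  have hx' : 1 - ε < ‖T (proj (Set.Iio m)ᶜ x) - proj (Set.Iio m) (T (proj (Set.Iio m)ᶜ x))‖ := by
    rw [← sub_proj_apply]
    simpa using hx
  obtain ⟨m', hm', hm⟩ := ((ht.eventually (lt_mem_nhds hx')).and (eventually_gt_atTop m)).exists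
  refine ⟨m', hm, _, ((norm_proj_apply_le _ _).trans (norm_proj_apply_le _ _)).trans hx1.le,
    fun n hn => ?_, hm'⟩
  by_contra h
  refine hn ?_
  rw [proj_proj, coords_proj, Set.indicator_of_notMem]
  exact fun h' => h ⟨not_lt.1 h'.2, h'.1⟩

/-- Up to a compact perturbation and composition with a contraction, an operator of essential norm
one maps the unit vectors to a coordinatewise null sequence with norms bounded below by one in the
limit. -/
theorem exists_coordinatewise_null [CompleteSpace X] (T : X →L[ℂ] X)
    (hT : ‖(Ideal.Quotient.mk (compactIdeal X) T : Calkin X)‖ = 1) :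
    ∃ C : X →L[ℂ] X, ‖C‖ ≤ 1 ∧ ∃ K ∈ compactIdeal X,
      (∀ n, Tendsto (fun k => coords ((T * C - K) (basis k)) n) atTop (𝓝 0)) ∧
      ∀ ε > 0, ∀ᶠ k in atTop, 1 - ε < ‖(T * C - K) (basis k)‖ := by
  obtain ⟨n, z, hn, hz⟩ := exists_strictMono_seq
    (fun k m => exists_block_norm_gt T hT m (pow_pos (one_half_pos (α := ℝ)) k))
  obtain ⟨κ, hκ⟩ := hn.exists_block_index
  obtain ⟨C₀, hC₀, hC₀z⟩ := exists_clm_apply_basis z κ (fun k i hi => hκ k i ((hz k).2.1 i hi))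
    fun k => (hz k).1
  have hb : ∀ k, coords (T (z k)) ∈ Set.univ.pi fun _ : ℕ => Metric.closedBall (0 : ℂ) ‖T‖ := by
    intro k i _
    rw [mem_closedBall_zero_iff]
    exact (norm_coords_le _ _).trans (T.le_of_opNorm_le_of_le le_rfl (hz k).1 |>.trans
      (mul_one _).le)
  -- Tychonoff on a countable product of discs yields a coordinatewise convergent subsequence.
  obtain ⟨g, -, φ, hφ, hg⟩ :=
    (isCompact_univ_pi fun _ : ℕ => isCompact_closedBall (0 : ℂ) ‖T‖).tendsto_subseq hb
  obtain ⟨J, hJ, hJb⟩ := exists_clm_basis_comp (X := X) φ hφ.injective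
  have hTC : ∀ k, (T * (C₀ * J)) (basis k) = T (z (φ k)) := fun k => by simp [hJb, hC₀z]
  have hg' : ∀ i, Tendsto (fun k => coords (T (z (φ k))) i) atTop (𝓝 (g i)) :=
    fun i => (tendsto_pi_nhds.1 hg) i
  obtain ⟨K, hK, hKg⟩ := exists_compact_of_tendsto (T * (C₀ * J)) g fun i => by
    simpa only [hTC] using hg' i
  have hK0 : ∀ k, K (basis k) = K (basis 0) := fun k => coords_injective (by rw [hKg, hKg])
  refine ⟨C₀ * J, (norm_mul_le _ _).trans (mul_le_one₀ hC₀ (norm_nonneg _) hJ), K, hK,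
    fun i => ?_, fun ε hε => ?_⟩
  · have := (hg' i).sub_const (g i)
    rw [sub_self] at this
    refine this.congr fun k => ?_
    rw [sub_apply, hTC, map_sub, Pi.sub_apply, hKg]
  -- The lower bound for `T (z (φ k))` lives past `n (φ k)`, and `K (basis k)` is one fixed vector
  -- whose tails vanish, so subtracting `K` costs at most `ε / 2` eventually.
  · have h1 : Tendsto (fun k => K (basis 0) - proj (Set.Iio (n (φ k))) (K (basis 0))) atTop
        (𝓝 0) := by
      have := (tendsto_proj_Iio (K (basis 0))).comp (hn.comp hφ).tendsto_atTop
      simpa using this.const_sub (K (basis 0))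
    have h2 : Tendsto (fun k => ((1 : ℝ) / 2) ^ φ k) atTop (𝓝 0) :=
      (tendsto_pow_atTop_nhds_zero_of_lt_one (by norm_num) (by norm_num)).comp hφ.tendsto_atTop
    filter_upwards [h1.norm.eventually (gt_mem_nhds (show ‖(0 : X)‖ < ε / 2 by simpa using hε)),
      h2.eventually (gt_mem_nhds (half_pos hε))] with k hk1 hk2
    have h3 := (hz (φ k)).2.2
    have h4 : ‖proj (Set.Iio (n (φ k)))ᶜ ((T * (C₀ * J) - K) (basis k))‖ ≤ _ :=
      norm_proj_apply_le _ _
    rw [sub_apply, hTC, hK0, map_sub] at h4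
    rw [sub_apply, hTC, hK0]
    rw [sub_proj_apply] at hk1 h3
    have h5 := norm_sub_norm_le (proj (Set.Iio (n (φ k)))ᶜ (T (z (φ k))))
      (proj (Set.Iio (n (φ k)))ᶜ (K (basis 0)))
    linarith

/-- The gliding hump: an image of a unit vector is normed, up to `ε`, by a functional supported in
a block beyond any given index. -/
theorem exists_hump (S : X →L[ℂ] X)
    (h0 : ∀ n, Tendsto (fun k => coords (S (basis k)) n) atTop (𝓝 0))
    (h1 : ∀ ε > 0, ∀ᶠ k in atTop, 1 - ε < ‖S (basis k)‖) (m : ℕ) {ε : ℝ} (hε : 0 < ε) :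
    ∃ m' > m, ∃ a : ℕ × (X →L[ℂ] ℂ), a.1 ∈ Set.Ico m m' ∧ ‖a.2‖ ≤ 1 ∧
      ‖S (basis a.1) - proj (Set.Ico m m') (S (basis a.1))‖ ≤ 2 * ε ∧
      ‖1 - a.2 (proj (Set.Ico m m') (S (basis a.1)))‖ ≤ 3 * ε := by
  have hm : Tendsto (fun k => ‖proj (Set.Iio m) (S (basis k))‖) atTop (𝓝 0) := by
    simp only [proj_Iio_eq_sum]
    have := (tendsto_finsetSum (Finset.range m)
      fun i _ => (h0 i).smul_const (basis i : X)).norm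
    simpa using this
  -- Placing `j` itself in `[m, m')` makes the indices of distinct blocks distinct.
  obtain ⟨j, ⟨hj, hj1⟩, hjm⟩ := (((hm.eventually (gt_mem_nhds hε)).and (h1 ε hε)).and
    (eventually_ge_atTop m)).exists
  set y := S (basis j)
  have hy : Tendsto (fun n => ‖y - proj (Set.Iio n) y‖) atTop (𝓝 0) := by
    have := ((tendsto_proj_Iio y).const_sub y).norm
    simpa using this
  obtain ⟨m', hm', hjm'⟩ := ((hy.eventually (gt_mem_nhds hε)).and (eventually_gt_atTop j)).exists
  have hdec : y - proj (Set.Ico m m') y = (y - proj (Set.Iio m') y) + proj (Set.Iio m) y := by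
    refine coords_injective ?_
    ext i
    have hmm : m < m' := hjm.trans_lt hjm'
    simp only [map_sub, map_add, coords_proj, Pi.sub_apply, Pi.add_apply, Set.indicator_apply,
      Set.mem_Ico, Set.mem_Iio]
    split_ifs <;> first | omega | simp
  have hs : ‖y - proj (Set.Ico m m') y‖ ≤ 2 * ε := by
    rw [hdec]
    linarith [norm_add_le (y - proj (Set.Iio m') y) (proj (Set.Iio m) y)]
  set w := proj (Set.Ico m m') y
  have hw : 1 - 3 * ε ≤ ‖w‖ := by linarith [norm_sub_norm_le y w]
  obtain ⟨f, hf, hfw⟩ := exists_dual_vector'' ℂ w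
  -- Since `‖w‖` may lie on either side of one, dividing by `max 1 ‖w‖` keeps the functional
  -- contractive and gives it the value `min 1 ‖w‖` at `w`.
  refine ⟨m', hjm.trans_lt hjm', (j, (((max 1 ‖w‖)⁻¹ : ℝ) : ℂ) • f), ⟨hjm, hjm'⟩, ?_, hs, ?_⟩
  · rw [norm_smul, Complex.norm_real, Real.norm_of_nonneg (by positivity)]
    exact mul_le_one₀ (inv_le_one_of_one_le₀ (le_max_left _ _)) (norm_nonneg _) hf
  · have : (1 : ℂ) - ((((max 1 ‖w‖)⁻¹ : ℝ) : ℂ) • f) w =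
        ((1 - (max 1 ‖w‖)⁻¹ * ‖w‖ : ℝ) : ℂ) := by
      simp [hfw]
    change ‖(1 : ℂ) - ((((max 1 ‖w‖)⁻¹ : ℝ) : ℂ) • f) w‖ ≤ _
    rw [this, Complex.norm_real, Real.norm_eq_abs]
    rcases le_total 1 ‖w‖ with h | h
    · rw [max_eq_right h, inv_mul_cancel₀ (by positivity)]
      simp [hε.le]
    · rw [max_eq_left h, inv_one, one_mul, abs_of_nonneg (by linarith)]
      linarith

theorem exists_contractions_one_sub_mem [CompleteSpace X] (S : X →L[ℂ] X)
    (h0 : ∀ n, Tendsto (fun k => coords (S (basis k)) n) atTop (𝓝 0))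
    (h1 : ∀ ε > 0, ∀ᶠ k in atTop, 1 - ε < ‖S (basis k)‖) :
    ∃ B C : X →L[ℂ] X, ‖B‖ ≤ 1 ∧ ‖C‖ ≤ 1 ∧ 1 - B * S * C ∈ compactIdeal X := by
  obtain ⟨n, a, hn, ha⟩ := exists_strictMono_seq
    (fun k m => exists_hump S h0 h1 m (pow_pos (one_half_pos (α := ℝ)) k))
  obtain ⟨κ, hκ⟩ := hn.exists_block_index
  obtain ⟨B, hB, hBf⟩ := exists_clm_of_functionals (fun k => (a k).2) (fun k => (ha k).2.1) κ
    (fun k => Set.Ico (n k) (n (k + 1))) hκ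
  obtain ⟨C, hC, hCb⟩ := exists_clm_basis_comp (X := X) (fun k => (a k).1) fun k l hkl => by
    have := hκ k _ (ha k).1
    have := hκ l _ (ha l).1
    simp_all
  refine ⟨B, C, hB, hC, mem_compactIdeal_of_summable _ ?_⟩
  -- With `ε = 2⁻ᵏ`, the constant is `3` from the functional not being exactly one on the hump plus
  -- `2` from the part of the image off the hump.
  have hs : Summable fun k => 5 * (1 / 2 : ℝ) ^ k := summable_geometric_two.mul_left 5
  refine Summable.of_nonneg_of_le (fun k => norm_nonneg _) (fun k => ?_) hs
  obtain ⟨-, hf, hk1, hk2⟩ := ha k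
  set y := S (basis (a k).1)
  set w := proj (Set.Ico (n k) (n (k + 1))) y
  have hBw : B w = ((a k).2 w) • basis k := by
    refine coords_injective ?_
    ext i
    rw [hBf, proj_proj]
    by_cases hik : i = k
    · subst hik
      simp [coords_basis, w]
    · have : Set.Ico (n i) (n (i + 1)) ∩ Set.Ico (n k) (n (k + 1)) = ∅ :=
        (hn.monotone.pairwise_disjoint_on_Ico_succ hik).inter_eq
      rw [this, proj_empty]
      simp [coords_basis, hik]
  have hdec : (1 - B * S * C) (basis k) = (1 - (a k).2 w) • basis k - B (y - w) := by
    rw [map_sub, hBw]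
    simp [hCb, y, sub_smul]
  rw [hdec]
  have h2 : ‖(1 - (a k).2 w) • (basis k : X)‖ ≤ ‖1 - (a k).2 w‖ := by
    rw [norm_smul]
    exact mul_le_of_le_one_right (norm_nonneg _) (norm_basis_le k)
  linarith [norm_sub_le ((1 - (a k).2 w) • (basis k : X)) (B (y - w)),
    norm_apply_le_of_norm_le_one hB (y - w)]

end

section

variable {X : Type*} [NormedAddCommGroup X] [NormedSpace ℂ X] [SequenceSpace X]

/-- The unit factors through every element of norm one of the Calkin algebra, with factors of
norm one. -/
theorem exists_factor_one [CompleteSpace X] (a : Calkin X) (ha : ‖a‖ = 1) :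
    ∃ b c : Calkin X, 1 = b * a * c ∧ ‖b‖ ≤ 1 ∧ ‖c‖ ≤ 1 := by
  obtain ⟨T, rfl⟩ := Ideal.Quotient.mk_surjective a
  obtain ⟨C₁, hC₁, K, hK, h0, h1⟩ := exists_coordinatewise_null T ha
  obtain ⟨B, C₂, hB, hC₂, hmem⟩ := exists_contractions_one_sub_mem _ h0 h1
  have hK0 : (Ideal.Quotient.mk (compactIdeal X) K : Calkin X) = 0 :=
    Ideal.Quotient.eq_zero_iff_mem.2 hK
  have h := Ideal.Quotient.eq_zero_iff_mem.2 hmem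
  simp only [map_sub, map_mul, map_one, hK0, sub_zero] at h
  refine ⟨Ideal.Quotient.mk _ B, Ideal.Quotient.mk _ (C₁ * C₂), ?_,
    (Submodule.Quotient.norm_mk_le (compactIdeal X) B).trans hB,
    (Submodule.Quotient.norm_mk_le (compactIdeal X) (C₁ * C₂)).trans
      ((norm_mul_le _ _).trans (mul_le_one₀ hC₁ (norm_nonneg _) hC₂))⟩
  rw [sub_eq_zero.1 h, map_mul]
  simp only [mul_assoc]

variable [Fact (¬ FiniteDimensional ℂ X)]

theorem exists_factor_one_norm_mul_norm [CompleteSpace X] (a : Calkin X) (ha : ‖a‖ = 1) :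
    ∃ b c : Calkin X, 1 = b * a * c ∧ ‖b‖ * ‖c‖ = 1 := by
  obtain ⟨b, c, h, hb, hc⟩ := exists_factor_one a ha
  refine ⟨b, c, h, le_antisymm (mul_le_one₀ hb (norm_nonneg _) hc) ?_⟩
  calc (1 : ℝ) = ‖b * a * c‖ := by rw [← h, norm_one]
    _ ≤ ‖b‖ * ‖a‖ * ‖c‖ := norm_mul₃_le
    _ = ‖b‖ * ‖c‖ := by rw [ha, mul_one]

/-- The identity factors through the projection by spreading the basis along `j` and reading it
back, and it is not compact in infinite dimension. -/
theorem proj_notMem_compactIdeal {A : Set ℕ} {j : ℕ → ℕ} (hj : Function.Injective j)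
    (hA : ∀ k, j k ∈ A) : (proj A : X →L[ℂ] X) ∉ compactIdeal X := by
  intro h
  obtain ⟨C, -, hC⟩ := exists_clm_basis_comp (X := X) j hj
  obtain ⟨B, -, hB⟩ := exists_clm_of_functionals (X := X) (fun k => coord (j k))
    (fun k => norm_coord_le _) (Function.invFun j) (fun k => {j k})
    (by rintro k _ rfl; exact Function.leftInverse_invFun hj k)
  have h1 : B * proj A * C ∈ compactIdeal X :=
    Ideal.mul_mem_right _ _ (Ideal.mul_mem_left _ _ h)
  have hb : ∀ k, (B * proj A * C : X →L[ℂ] X) (basis k) = basis k := fun k => by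
    refine coords_injective ?_
    ext i
    simp [hC, hB, coords_basis, hA i, Pi.single_apply, hj.eq_iff]
  have h2 : B * proj A * C = 1 := by
    ext x
    have hx := (hasSum_basis x).mapL (B * proj A * C)
    simp only [map_smul, hb] at hx
    exact hx.unique (hasSum_basis x)
  rw [h2] at h1
  exact (Fact.out : ¬ FiniteDimensional ℂ X)
    ((isCompactOperator_id_iff_finiteDimensional (𝕜 := ℂ)).1 h1)

variable (X) in
theorem exists_zero_divisors [CompleteSpace X] : ∃ e f : Calkin X, e * f = 0 ∧ e ≠ 0 ∧ f ≠ 0 := by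
  refine ⟨Ideal.Quotient.mk _ (proj {n | Even n}), Ideal.Quotient.mk _ (proj {n | Even n}ᶜ), ?_,
    ?_, ?_⟩
  · have : (proj {n | Even n} * proj {n | Even n}ᶜ : X →L[ℂ] X) = 0 := by
      ext x
      simp [proj_proj, proj_empty]
    rw [← map_mul, this, map_zero]
  · rw [Ne, Ideal.Quotient.eq_zero_iff_mem]
    exact proj_notMem_compactIdeal (j := fun k => 2 * k)
      (mul_right_injective₀ two_ne_zero) fun k => by simp
  · rw [Ne, Ideal.Quotient.eq_zero_iff_mem]
    exact proj_notMem_compactIdeal (j := fun k => 2 * k + 1)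
      (fun a b h => by simpa using h) fun k => by simp

end

end SequenceSpace

/-! ### The spaces `ℓᵖ` and `c₀` are sequence spaces -/

/-- The `p`-th powers of norms add over disjoint supports, and a sum over `n` grouped by `κ` is
dominated block by block. -/
theorem lp.exists_blockwise {p : ℝ≥0∞} [Fact (1 ≤ p)] (hp : p ≠ ∞) (x : lp (fun _ : ℕ => ℂ) p)
    (δ κ : ℕ → ℕ) (u v : ℕ → lp (fun _ : ℕ => ℂ) p)
    (hu : ∀ k n, u k n = if δ n = k then x n else 0) (hv : ∀ k, ‖v k‖ ≤ ‖u k‖) :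
    ∃ y : lp (fun _ : ℕ => ℂ) p, (⇑y = fun n => v (κ n) n) ∧ ‖y‖ ≤ ‖x‖ := by
  classical
  have hp' : 0 < p.toReal :=
    ENNReal.toReal_pos (zero_lt_one.trans_le (Fact.out : 1 ≤ p)).ne' hp
  have hus : ∀ t : Finset ℕ, ∑ k ∈ t, ‖u k‖ ^ p.toReal ≤ ‖x‖ ^ p.toReal := by
    intro t
    simp only [lp.norm_rpow_eq_tsum hp']
    rw [← Summable.tsum_finsetSum fun k _ => (lp.memℓp (u k)).summable hp']
    refine Summable.tsum_le_tsum (fun n => ?_)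
      (summable_sum fun k _ => (lp.memℓp (u k)).summable hp') ((lp.memℓp x).summable hp')
    calc ∑ k ∈ t, ‖u k n‖ ^ p.toReal
        = ∑ k ∈ t, if δ n = k then ‖x n‖ ^ p.toReal else 0 := by
          refine Finset.sum_congr rfl fun k _ => ?_
          rw [hu]
          split_ifs <;> simp [hp'.ne']
      _ ≤ ‖x n‖ ^ p.toReal := by
          rw [Finset.sum_ite_eq]
          split_ifs
          · exact le_rfl
          · positivity
  have hs : ∀ s : Finset ℕ, ∑ n ∈ s, ‖v (κ n) n‖ ^ p.toReal ≤ ‖x‖ ^ p.toReal := by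
    intro s
    calc ∑ n ∈ s, ‖v (κ n) n‖ ^ p.toReal
        = ∑ k ∈ s.image κ, ∑ n ∈ s with κ n = k, ‖v (κ n) n‖ ^ p.toReal :=
          (Finset.sum_fiberwise_of_maps_to (fun n hn => Finset.mem_image_of_mem κ hn) _).symm
      _ = ∑ k ∈ s.image κ, ∑ n ∈ s with κ n = k, ‖v k n‖ ^ p.toReal :=
          Finset.sum_congr rfl fun k _ => Finset.sum_congr rfl fun n hn => by
            rw [(Finset.mem_filter.1 hn).2]
      _ ≤ ∑ k ∈ s.image κ, ‖u k‖ ^ p.toReal := Finset.sum_le_sum fun k _ =>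
          (lp.sum_rpow_le_norm_rpow hp' _ _).trans
            (Real.rpow_le_rpow (norm_nonneg _) (hv k) hp'.le)
      _ ≤ ‖x‖ ^ p.toReal := hus _
  exact ⟨⟨fun n => v (κ n) n, memℓp_gen' hs⟩, rfl,
    lp.norm_le_of_forall_sum_le hp' (norm_nonneg _) hs⟩

/-- If the partial sums of the unit vectors grow sublinearly, then the images of the unit vectors
under an operator can only converge coordinatewise to zero. -/
theorem eq_zero_of_tendsto_of_norm_sum_div_tendsto_zero {X : Type*} [NormedAddCommGroup X]
    [NormedSpace ℂ X] (e : ℕ → X)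
    (he : Tendsto (fun N : ℕ => (N : ℝ)⁻¹ * ‖∑ k ∈ Finset.range N, e k‖) atTop (𝓝 0))
    (f : X →L[ℂ] ℂ) {c : ℂ} (hf : Tendsto (fun k => f (e k)) atTop (𝓝 c)) : c = 0 := by
  -- The Cesàro means of `f (e k)` also tend to `c`, but they are `f` applied to the averages of the
  -- `e k`, which tend to zero in norm.
  refine tendsto_nhds_unique hf.cesaro_smul ?_
  refine squeeze_zero_norm (fun N => ?_) (by simpa using he.const_mul ‖f‖)
  rw [← map_sum, norm_smul, norm_inv, Real.norm_natCast, mul_left_comm]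
  exact mul_le_mul_of_nonneg_left (f.le_opNorm _) (by positivity)

/-- The sum has norm `N ^ (1 / p)`, with exponent below one. -/
theorem lp.tendsto_norm_sum_single_div {p : ℝ≥0∞} (hp1 : 1 < p) (hp : p ≠ ∞) :
    Tendsto (fun N : ℕ => (N : ℝ)⁻¹ *
      ‖∑ k ∈ Finset.range N, (lp.single p k 1 : lp (fun _ : ℕ => ℂ) p)‖) atTop (𝓝 0) := by
  have hp1' : 1 < p.toReal := by
    simpa using (ENNReal.toReal_lt_toReal ENNReal.one_ne_top hp).2 hp1
  have hp' : 0 < p.toReal := zero_lt_one.trans hp1'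
  have hn : ∀ N : ℕ, ‖∑ k ∈ Finset.range N, (lp.single p k 1 : lp (fun _ : ℕ => ℂ) p)‖ =
      (N : ℝ) ^ (p.toReal)⁻¹ := by
    intro N
    have h := lp.norm_sum_single (E := fun _ : ℕ => ℂ) hp' (fun _ => 1) (Finset.range N)
    rw [Real.eq_rpow_inv (lp.norm_nonneg' _) (by positivity) hp'.ne', h]
    simp
  simp only [hn]
  have h0 : 0 < 1 - (p.toReal)⁻¹ := sub_pos.2 (inv_lt_one_of_one_lt₀ hp1')
  refine ((tendsto_rpow_neg_atTop h0).comp tendsto_natCast_atTop_atTop).congr' ?_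
  filter_upwards [eventually_gt_atTop 0] with N hN
  have hN' : (0 : ℝ) < N := Nat.cast_pos.2 hN
  rw [Function.comp_apply, ← Real.rpow_neg_one (N : ℝ), ← Real.rpow_add hN']
  congr 1
  ring

theorem lp.exists_functional_apply_single :
    ∃ f : lp (fun _ : ℕ => ℂ) 1 →L[ℂ] ℂ, ∀ k, f (lp.single 1 k 1) = 1 := by
  have hsum : ∀ x : lp (fun _ : ℕ => ℂ) 1, Summable fun n => ‖x n‖ := fun x => by
    simpa using (lp.memℓp x).summable (by simp)
  refine ⟨LinearMap.mkContinuous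
    { toFun := fun x => ∑' n, x n
      map_add' := fun x y => (hsum x).of_norm.tsum_add (hsum y).of_norm
      map_smul' := fun c x => by simp [tsum_mul_left] } 1 fun x => ?_, fun k => ?_⟩
  · have := lp.norm_rpow_eq_tsum (by simp) x
    simp only [ENNReal.toReal_one, Real.rpow_one] at this
    rw [one_mul, this]
    exact norm_tsum_le_tsum_norm (hsum x)
  · change ∑' n, (lp.single 1 k 1 : lp (fun _ : ℕ => ℂ) 1) n = 1
    rw [lp.coeFn_single]
    simp

/-- For `p = 1`, a coordinatewise limit of a bounded sequence lies in `ℓ¹`, and the summation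
functional times this limit is the required rank-one operator. For `p > 1` the limit is zero and `K
= 0` works. -/
theorem lp.exists_compact_of_tendsto {p : ℝ≥0∞} [Fact (1 ≤ p)] (hp : p ≠ ∞)
    (S : lp (fun _ : ℕ => ℂ) p →L[ℂ] lp (fun _ : ℕ => ℂ) p) (g : ℕ → ℂ)
    (hg : ∀ n, Tendsto (fun k => S (lp.single p k 1) n) atTop (𝓝 (g n))) :
    ∃ K ∈ compactIdeal (lp (fun _ : ℕ => ℂ) p), ∀ k, ⇑(K (lp.single p k 1)) = g := by
  rcases (Fact.out : 1 ≤ p).eq_or_lt with rfl | hp1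
  · obtain ⟨f, hf⟩ := lp.exists_functional_apply_single
    have hb : Bornology.IsBounded
        (Set.range fun k => S (lp.single 1 k 1 : lp (fun _ : ℕ => ℂ) 1)) := by
      refine isBounded_iff_forall_norm_le.2 ⟨‖S‖, ?_⟩
      rintro _ ⟨k, rfl⟩
      exact (S.le_opNorm _).trans (by simp [lp.norm_single])
    have hmem : Memℓp g 1 := lp.memℓp_of_tendsto (l := atTop) hb (tendsto_pi_nhds.2 hg)
    refine ⟨f.smulRight ⟨g, hmem⟩, smulRight_mem_compactIdeal _ _, fun k => ?_⟩
    simp [hf]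
  · refine ⟨0, zero_mem _, fun k => ?_⟩
    ext n
    have hS : ∀ k, ((lp.evalCLM ℂ (fun _ : ℕ => ℂ) p n).comp S) (lp.single p k 1) =
        S (lp.single p k 1) n := fun k => rfl
    have h := eq_zero_of_tendsto_of_norm_sum_div_tendsto_zero (fun k => lp.single p k 1)
      (lp.tendsto_norm_sum_single_div hp1 hp) ((lp.evalCLM ℂ (fun _ : ℕ => ℂ) p n).comp S)
      (c := g n) (by simpa only [hS] using hg n)
    rw [h]
    rfl

/-- The space `ℓᵖ` is a sequence space for `1 ≤ p < ∞`. -/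
@[reducible]
noncomputable def lp.sequenceSpace {p : ℝ≥0∞} [Fact (1 ≤ p)] (hp : p ≠ ∞) :
    SequenceSpace (lp (fun _ : ℕ => ℂ) p) where
  coords := { toFun := fun x => ⇑x, map_add' := fun _ _ => rfl, map_smul' := fun _ _ => rfl }
  norm_coords_le x n :=
    lp.norm_apply_le_norm (zero_lt_one.trans_le (Fact.out : 1 ≤ p)).ne' x n
  basis n := lp.single p n 1
  coords_basis n := lp.coeFn_single p n 1
  norm_basis_le n := by
    rw [lp.norm_single (zero_lt_one.trans_le (Fact.out : 1 ≤ p)), norm_one]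
  hasSum_basis x := by
    convert lp.hasSum_single hp x using 2 with n
    rw [← lp.single_smul, smul_eq_mul, mul_one]
    rfl
  exists_of_norm_le x f hf := by
    have hp' : 0 < p.toReal :=
      ENNReal.toReal_pos (zero_lt_one.trans_le (Fact.out : 1 ≤ p)).ne' hp
    have hs : ∀ s : Finset ℕ, ∑ n ∈ s, ‖f n‖ ^ p.toReal ≤ ‖x‖ ^ p.toReal := fun s =>
      (Finset.sum_le_sum fun n _ => Real.rpow_le_rpow (norm_nonneg _) (hf n) hp'.le).trans
        (lp.sum_rpow_le_norm_rpow hp' x s)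
    exact ⟨⟨f, memℓp_gen' hs⟩, rfl, lp.norm_le_of_forall_sum_le hp' (norm_nonneg _) hs⟩
  exists_blockwise := lp.exists_blockwise hp
  exists_compact_of_tendsto := lp.exists_compact_of_tendsto hp

/-! ### The space `c₀`. -/

namespace ZeroAtInftyContinuousMap

theorem norm_apply_le (x : C₀(ℕ, ℂ)) (n : ℕ) : ‖x n‖ ≤ ‖x‖ := by
  rw [← norm_toBCF_eq_norm]
  exact x.toBCF.norm_coe_le_norm n

theorem norm_le_of_forall {x : C₀(ℕ, ℂ)} {C : ℝ} (hC : 0 ≤ C) (h : ∀ n, ‖x n‖ ≤ C) : ‖x‖ ≤ C := by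
  rw [← norm_toBCF_eq_norm]
  exact (BoundedContinuousFunction.norm_le hC).2 h

theorem tendsto_cofinite (x : C₀(ℕ, ℂ)) : Tendsto x cofinite (𝓝 0) := by
  rw [← cocompact_eq_cofinite]
  exact x.zero_at_infty'

theorem exists_coe_eq {f : ℕ → ℂ} {C : ℝ} (hC : 0 ≤ C) (hf : Tendsto f cofinite (𝓝 0))
    (h : ∀ n, ‖f n‖ ≤ C) : ∃ y : C₀(ℕ, ℂ), ⇑y = f ∧ ‖y‖ ≤ C :=
  ⟨⟨⟨f, continuous_of_discreteTopology⟩, by rwa [cocompact_eq_cofinite]⟩, rfl,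
    norm_le_of_forall hC h⟩

theorem finite_le_norm (x : C₀(ℕ, ℂ)) {ε : ℝ} (hε : 0 < ε) : {n | ε ≤ ‖x n‖}.Finite := by
  have := (Metric.tendsto_nhds.1 x.tendsto_cofinite ε hε)
  simpa [Filter.eventually_cofinite] using this

theorem exists_blockwise (x : C₀(ℕ, ℂ)) (δ κ : ℕ → ℕ) (u v : ℕ → C₀(ℕ, ℂ))
    (hu : ∀ k n, u k n = if δ n = k then x n else 0) (hv : ∀ k, ‖v k‖ ≤ ‖u k‖) :
    ∃ y : C₀(ℕ, ℂ), (⇑y = fun n => v (κ n) n) ∧ ‖y‖ ≤ ‖x‖ := by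
  refine exists_coe_eq (norm_nonneg x) (Metric.tendsto_nhds.2 fun ε hε => ?_) fun n =>
    (norm_apply_le _ _).trans ((hv _).trans (norm_le_of_forall (norm_nonneg _) fun i => ?_))
  -- An entry of size `ε` in `v k` forces `‖u k‖ ≥ ε`, hence an entry of `x` of size at least `ε /
  -- 2` with label `k`. Only finitely many `k` qualify, and each `v k` has finitely many such
  -- entries.
  · have hx := (x.finite_le_norm (half_pos hε)).image δ
    have hfin := hx.biUnion fun k _ => (v k).finite_le_norm hε
    simp only [dist_zero_right, Filter.eventually_cofinite, not_lt]
    refine hfin.subset fun n hn => ?_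
    refine Set.mem_biUnion (x := κ n) ?_ hn
    by_contra hk
    have hle : ‖u (κ n)‖ ≤ ε / 2 := norm_le_of_forall (half_pos hε).le fun i => by
      rw [hu]
      split_ifs with hi
      · by_contra hlt
        exact hk ⟨i, (not_le.1 hlt).le, hi⟩
      · simpa using (half_pos hε).le
    have hn' : ε ≤ ‖v (κ n) n‖ := hn
    linarith [norm_apply_le (v (κ n)) n, hv (κ n)]
  · rw [hu]
    split_ifs
    · exact norm_apply_le x i
    · simp

/-- The unit vectors of `c₀`. -/
noncomputable def unitVec (n : ℕ) : C₀(ℕ, ℂ) :=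
  ⟨⟨Pi.single n 1, continuous_of_discreteTopology⟩, by
    rw [cocompact_eq_cofinite]
    refine tendsto_const_nhds.congr' ?_
    filter_upwards [(Set.finite_singleton n).compl_mem_cofinite] with m hm
    simp at hm
    simp [hm]⟩

@[simp]
theorem coe_unitVec (n : ℕ) : ⇑(unitVec n) = Pi.single n 1 := rfl

theorem coe_finsetSum {ι : Type*} (s : Finset ι) (f : ι → C₀(ℕ, ℂ)) :
    ⇑(∑ i ∈ s, f i) = ∑ i ∈ s, ⇑(f i) :=
  map_sum ({ toFun := fun x => ⇑x, map_zero' := rfl, map_add' := fun _ _ => rfl } :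
    C₀(ℕ, ℂ) →+ (ℕ → ℂ)) f s

theorem sum_smul_unitVec_apply (s : Finset ℕ) (c : ℕ → ℂ) (n : ℕ) :
    (∑ i ∈ s, c i • unitVec i) n = if n ∈ s then c n else 0 := by
  simp [coe_finsetSum, Pi.single_apply]

theorem hasSum_smul_unitVec (x : C₀(ℕ, ℂ)) : HasSum (fun n => x n • unitVec n) x := by
  refine Metric.tendsto_nhds.2 fun ε hε => ?_
  filter_upwards [eventually_ge_atTop (x.finite_le_norm (half_pos hε)).toFinset] with s hs
  rw [dist_eq_norm]
  refine (norm_le_of_forall (half_pos hε).le fun n => ?_).trans_lt (half_lt_self hε)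
  rw [sub_apply, sum_smul_unitVec_apply]
  split_ifs with hn
  · simpa using (half_pos hε).le
  · have : ¬ ε / 2 ≤ ‖x n‖ := fun h => hn (hs (by simpa using h))
    simpa using (not_le.1 this).le

theorem exists_compact_of_tendsto (S : C₀(ℕ, ℂ) →L[ℂ] C₀(ℕ, ℂ)) (g : ℕ → ℂ)
    (hg : ∀ n, Tendsto (fun k => S (unitVec k) n) atTop (𝓝 (g n))) :
    ∃ K ∈ compactIdeal C₀(ℕ, ℂ), ∀ k, ⇑(K (unitVec k)) = g := by
  refine ⟨0, zero_mem _, fun k => ?_⟩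
  -- Partial sums of the unit vectors have norm at most one in `c₀`.
  have he : Tendsto (fun N : ℕ => (N : ℝ)⁻¹ * ‖∑ k ∈ Finset.range N, unitVec k‖) atTop (𝓝 0) := by
    refine squeeze_zero (fun N => by positivity) (fun N => ?_)
      (tendsto_inv_atTop_zero.comp tendsto_natCast_atTop_atTop)
    refine mul_le_of_le_one_right (by positivity) (norm_le_of_forall zero_le_one fun n => ?_)
    have := sum_smul_unitVec_apply (Finset.range N) (fun _ => 1) n
    simp only [one_smul] at this
    rw [this]
    split_ifs <;> simp
  ext n
  have := eq_zero_of_tendsto_of_norm_sum_div_tendsto_zero _ he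
    ((LinearMap.mkContinuous
      { toFun := fun x : C₀(ℕ, ℂ) => x n
        map_add' := fun x y => rfl
        map_smul' := fun c x => rfl } 1 fun x => by
          simpa using norm_apply_le x n).comp S) (hg n)
  simp [this]

noncomputable instance : SequenceSpace C₀(ℕ, ℂ) where
  coords := { toFun := fun x => ⇑x, map_add' := fun _ _ => rfl, map_smul' := fun _ _ => rfl }
  norm_coords_le := norm_apply_le
  basis := unitVec
  coords_basis := coe_unitVec
  norm_basis_le n := norm_le_of_forall zero_le_one fun i => by
    rw [coe_unitVec, Pi.single_apply]
    split_ifs <;> simp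
  hasSum_basis := hasSum_smul_unitVec
  exists_of_norm_le x f hf := by
    refine exists_coe_eq (norm_nonneg x) ?_ fun n => (hf n).trans (norm_apply_le x n)
    exact squeeze_zero_norm hf (by simpa using x.tendsto_cofinite.norm)
  exists_blockwise := exists_blockwise
  exists_compact_of_tendsto := exists_compact_of_tendsto

end ZeroAtInftyContinuousMap

/-! ### Ultrapowers -/

section Ultrapower

variable {ι : Type*} (U : Ultrafilter ι) {A : Type*} [NormedRing A]

theorem exists_lp_infty_coe_eq {f : ι → A} {C : ℝ} (h : ∀ i, ‖f i‖ ≤ C) :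
    ∃ a : lp (fun _ : ι => A) ∞, ⇑a = f :=
  ⟨⟨f, memℓp_infty ⟨C, by rintro _ ⟨i, rfl⟩; exact h i⟩⟩, rfl⟩

variable [NormOneClass A]

/-- If the unit of `A` factors contractively through every element of norm one, then it factors
through every non-zero element of an ultrapower. -/
theorem BanachUltrapower.exists_factor_one [NormedAlgebra ℂ A]
    (hA : ∀ a : A, ‖a‖ = 1 → ∃ b c : A, 1 = b * a * c ∧ ‖b‖ ≤ 1 ∧ ‖c‖ ≤ 1)
    (a : BanachUltrapower U A) (ha : a ≠ 0) : ∃ b c : BanachUltrapower U A, 1 = b * a * c := by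
  obtain ⟨a, rfl⟩ := Ideal.Quotient.mk_surjective a
  rw [Ne, Ideal.Quotient.eq_zero_iff_mem] at ha
  -- For an ultrafilter, failure of convergence to zero gives a lower bound on a large set, not
  -- merely frequently.
  obtain ⟨r, hr, hev⟩ : ∃ r > 0, ∀ᶠ i in (U : Filter ι), r ≤ ‖a i‖ := by
    by_contra! h
    refine ha (Metric.tendsto_nhds.2 fun ε hε => ?_)
    simpa using h ε hε
  -- The bounds `1` and `r⁻¹` do not depend on `x`, so the chosen factors form bounded families;
  -- where `‖x‖ < r` the factors are set to zero.
  have key : ∀ x : A, ∃ b c : A, ‖b‖ ≤ 1 ∧ ‖c‖ ≤ r⁻¹ ∧ (r ≤ ‖x‖ → b * x * c = 1) := by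
    intro x
    by_cases hx : r ≤ ‖x‖
    · have hx0 : 0 < ‖x‖ := hr.trans_le hx
      obtain ⟨b, c, h, hb, hc⟩ := hA (((‖x‖⁻¹ : ℝ) : ℂ) • x) (by
        rw [norm_smul, Complex.norm_real, norm_inv, norm_norm, inv_mul_cancel₀ hx0.ne'])
      refine ⟨b, ((‖x‖⁻¹ : ℝ) : ℂ) • c, hb, ?_, fun _ => ?_⟩
      · rw [norm_smul, Complex.norm_real, norm_inv, norm_norm]
        exact (mul_le_of_le_one_right (by positivity) hc).trans (inv_anti₀ hr hx)
      · rw [h, mul_smul_comm, mul_smul_comm, smul_mul_assoc]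
    · exact ⟨0, 0, by simp, by simpa using hr.le, fun h => absurd h hx⟩
  choose b c hb hc hbc using key
  obtain ⟨b', hb'⟩ := exists_lp_infty_coe_eq (f := fun i => b (a i)) fun i => hb _
  obtain ⟨c', hc'⟩ := exists_lp_infty_coe_eq (f := fun i => c (a i)) fun i => hc _
  refine ⟨Ideal.Quotient.mk _ b', Ideal.Quotient.mk _ c', ?_⟩
  rw [← map_mul, ← map_mul, ← map_one (Ideal.Quotient.mk (nullIdeal U A)), Ideal.Quotient.eq]
  refine tendsto_const_nhds.congr' ?_
  filter_upwards [hev] with i hi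
  have : (1 - b' * a * c' : lp (fun _ : ι => A) ∞) i = 1 - b' i * a i * c' i := rfl
  rw [this, hb', hc', hbc _ hi]
  simp

theorem BanachUltrapower.mk_eq_zero_iff_of_const {a : lp (fun _ : ι => A) ∞} {x : A}
    (h : ∀ i, a i = x) :
    (Ideal.Quotient.mk (nullIdeal U A) a : BanachUltrapower U A) = 0 ↔ x = 0 := by
  rw [Ideal.Quotient.eq_zero_iff_mem]
  change Tendsto (fun i => ‖a i‖) U (𝓝 0) ↔ _
  simp [h, tendsto_const_nhds_iff]

/-- Ultrapowers of an algebra with zero divisors are not division algebras. -/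
theorem BanachUltrapower.not_forall_isUnit {e f : A} (hef : e * f = 0) (he : e ≠ 0) (hf : f ≠ 0) :
    ¬ ∀ a : BanachUltrapower U A, a ≠ 0 → IsUnit a := by
  intro h
  obtain ⟨e', he'⟩ := exists_lp_infty_coe_eq (ι := ι) (f := fun _ => e) fun _ => le_rfl
  obtain ⟨f', hf'⟩ := exists_lp_infty_coe_eq (ι := ι) (f := fun _ => f) fun _ => le_rfl
  have hu := h (Ideal.Quotient.mk _ e') fun h0 =>
    he ((mk_eq_zero_iff_of_const U fun i => congrFun he' i).1 h0)
  have h0 : (Ideal.Quotient.mk (nullIdeal U A) e' : BanachUltrapower U A) *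
      Ideal.Quotient.mk (nullIdeal U A) f' = 0 := by
    rw [← map_mul, mk_eq_zero_iff_of_const (x := 0)]
    intro i
    rw [← hef, lp.infty_coeFn_mul, Pi.mul_apply, he', hf']
  exact hf ((mk_eq_zero_iff_of_const U fun i => congrFun hf' i).1 (hu.mul_right_eq_zero.1 h0))

end Ultrapower

theorem SequenceSpace.isPurelyInfinite_ultrapower {X : Type*} [NormedAddCommGroup X]
    [NormedSpace ℂ X] [CompleteSpace X] [SequenceSpace X] [Fact (¬ FiniteDimensional ℂ X)]
    {ι : Type*} (U : Ultrafilter ι) : IsPurelyInfinite (BanachUltrapower U (Calkin X)) := by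
  obtain ⟨e, f, hef, he, hf⟩ := exists_zero_divisors X
  exact ⟨BanachUltrapower.not_forall_isUnit U hef he hf,
    BanachUltrapower.exists_factor_one U exists_factor_one⟩

theorem proposition2p11 :
    (∀ (p : ℝ≥0∞) [Fact (1 ≤ p)], p ≠ ∞ →
      (∀ a : Calkin (lp (fun _ : ℕ => ℂ) p), ‖a‖ = 1 →
        ∃ b c : Calkin (lp (fun _ : ℕ => ℂ) p), 1 = b * a * c ∧ ‖b‖ * ‖c‖ = 1) ∧
      (∀ (ι : Type*) (U : Ultrafilter ι), ¬ CountableInterFilter (U : Filter ι) →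
        IsPurelyInfinite (BanachUltrapower U (Calkin (lp (fun _ : ℕ => ℂ) p))))) ∧
    (∀ a : Calkin C₀(ℕ, ℂ), ‖a‖ = 1 →
      ∃ b c : Calkin C₀(ℕ, ℂ), 1 = b * a * c ∧ ‖b‖ * ‖c‖ = 1) ∧
    (∀ (ι : Type*) (U : Ultrafilter ι), ¬ CountableInterFilter (U : Filter ι) →
      IsPurelyInfinite (BanachUltrapower U (Calkin C₀(ℕ, ℂ)))) := by
  refine ⟨fun p _ hp => ?_, SequenceSpace.exists_factor_one_norm_mul_norm,
    fun ι U _ => SequenceSpace.isPurelyInfinite_ultrapower U⟩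
  have := lp.sequenceSpace hp
  exact ⟨SequenceSpace.exists_factor_one_norm_mul_norm,
    fun ι U _ => SequenceSpace.isPurelyInfinite_ultrapower U⟩
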